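/- Let $i\le w$ be positive integers. The Johnson graph $J(n,w)$ has as vertices the binary vectors of length $n$ with exactly $w$ ones, two of them being adjacent when they have exactly $w-1$ common ones; $\operatorname{supp}(x)$ denotes the set of coordinate positions of the ones of $x$. Put $\lambda_i(n,w)=(w-i)(n-w-i)-i$. A real-valued function $f$ on the vertices of $J(n,w)$ is a $\lambda$-eigenfunction if $\lambda f(x)=\sum_{y\sim x}f(y)$ for every vertex $x$, and $\operatorname{supp}(f)$ is the set of vertices where $f$ is nonzero. Given disjoint sets $M,M'$ of $i$ coordinate positions each and a bijection $m\mapsto m'$ from $M$ onto $M'$ (write $I'=\{m':m\in I\}$ for $I\subseteq M$), let $f^{i,w,n}$ be the function on the vertices of $J(n,w)$ with $$f^{i,w,n}(x)=(-1)^{|M\cap \operatorname{supp}(x)|}\quad\text{if } |\operatorname{supp}(x)\cap(M\cup M')|=i \text{ and } (\operatorname{supp}(x)\cap M)'\cup(\operatorname{supp}(x)\cap M')=M',$$ and $f^{i,w,n}(x)=0$ otherwise. Then there is a number $n_0=n_0(i,w)\ge 2i$ such that for all $n\ge n_0$: 1. every nonzero $\lambda_i(n,w)$-eigenfunction $f$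 of $J(n,w)$ satisfies $$|\operatorname{supp}(f)|\ge 2^i\binom{n-2i}{w-i};$$ 2. if equality holds for such an $f$, then $f$ is a nonzero scalar multiple of a function $f^{i,w,n}$, for some choice of $M$, $M'$ and the bijection between them; 3. equality is attained by these functions: for every choice of $M$, $M'$ and the bijection, $f^{i,w,n}$ is a $\lambda_i(n,w)$-eigenfunction of $J(n,w)$ with $|\operatorname{supp}(f^{i,w,n})|=2^i\binom{n-2i}{w-i}$. -/

import Mathlib

/-- The vertices of the Johnson graph `J(n,w)`: binary vectors of length `n` with exactly `w` ones.
A binary vector is given by its support, a set of coordinate positions. -/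
abbrev JohnsonVertex (n w : ℕ) : Type := {x : Finset (Fin n) // x.card = w}

/-- The Johnson graph `J(n,w)`: two vectors of weight `w` are adjacent when they have exactly
`w - 1` common ones. -/
def johnsonGraph (n w : ℕ) : SimpleGraph (JohnsonVertex n w) where
  Adj x y := (x.1 ∩ y.1).card + 1 = w
  symm := ⟨fun x y h => by rw [Finset.inter_comm]; exact h⟩
  loopless := ⟨fun x h => by
    rw [Finset.inter_self, x.2] at h
    omega⟩

instance johnsonGraphDecidableAdj (n w : ℕ) : DecidableRel (johnsonGraph n w).Adj :=
  fun x y => inferInstanceAs (Decidable ((x.1 ∩ y.1).card + 1 = w))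

/-- A real-valued function on the vertices of a finite graph is a `μ`-eigenfunction when
`μ f(x)` is the sum of the values of `f` over the neighbours of `x`, for every vertex `x`
(the zero function is allowed). -/
def IsEigenfunction {V : Type*} [Fintype V] (G : SimpleGraph V) [DecidableRel G.Adj]
    (μ : ℝ) (f : V → ℝ) : Prop :=
  ∀ x, μ * f x = ∑ y ∈ G.neighborFinset x, f y

/-- The number `λ_i(n,w) = (w - i)(n - w - i) - i`. -/
def johnsonEigenvalue (i n w : ℕ) : ℝ :=
  ((w : ℝ) - i) * ((n : ℝ) - w - i) - i

/-- Two disjoint sets `M`, `M'` of `i` coordinate positions each, with a one-to-one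
correspondence `prime` from `M` onto `M'` (the values of `prime` outside `M` play no role). -/
structure CoordinatePairing (n i : ℕ) where
  M : Finset (Fin n)
  M' : Finset (Fin n)
  prime : Fin n → Fin n
  card_M : M.card = i
  card_M' : M'.card = i
  disjoint : Disjoint M M'
  bijOn : Set.BijOn prime M M'

/-- The function `f^{i,w,n}` on the vertices of `J(n,w)` attached to `M`, `M'` and the
correspondence `'` between them. -/
def CoordinatePairing.toFun {n i : ℕ} (P : CoordinatePairing n i) (w : ℕ) :
    JohnsonVertex n w → ℝ := fun x =>
  if (x.1 ∩ (P.M ∪ P.M')).card = i ∧ (x.1 ∩ P.M).image P.prime ∪ (x.1 ∩ P.M') = P.M' then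
    (-1) ^ (P.M ∩ x.1).card
  else 0

/-!
Functions on the `w`-subsets of an `n`-set are studied through the operators `upSum` and `downSum`
between consecutive levels of the subset lattice. They are adjoint and satisfy the commutation
relation `downSum ∘ upSum - upSum ∘ downSum = n - 2k` on level `k`, and the adjacency operator of
`J(n,w)` is `upSum ∘ downSum - w`. Descending from level `w` to level `i` with `downSum`, one finds
that every `λ_i(n,w)`-eigenfunction has the form `f(x) = ∑ g(I)`, the sum being over the `i`-subsets
`I` of `x`, where `g` sums to zero over the `i`-sets containing any given `(i - 1)`-set: `g` is a
null design (`exists_isNullDesign_subsetSum`).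

For a null design and a set `I` of its support, inclusion-exclusion gives
`∑ g(J) = ± g(I)` over the sets `J` with `J ∩ I = C`, for each `C ⊆ I` (`sum_inter_eq`). Hence every
`C ⊆ I` is a trace of the support on `I`, and the support has at least `2 ^ i` elements. If it has
exactly `2 ^ i`, each trace occurs once and the values are determined up to a common factor.
Comparing signs for `I` and for the set `J` arising from it by exchanging `a` for `a'`, one finds
that each set of the support contains exactly one of `a` and `a'`, so `g` is a multiple of
`∏ (x_{m'} - x_m)` (`exists_eq_altProd_of_card_support`), and so is `f`.

It remains to compare the supports of `f` and `g`. The inclusion matrix of `i`-sets against `w`-sets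
of an `(i + w)`-set is injective (`eq_zero_of_subsetSum_eq_zero`); a double count based on this
bounds the support of `g` independently of `n` as soon as `f` has at most
`2 ^ i * (n - 2i).choose (w - i)` nonzero values (`card_support_le`). When the support of `g` is
bounded, each of its sets `I` yields `(n - O(1)).choose (w - i)` sets `x ⊇ I` on which `f` equals
`g(I)`, so for large `n` the support of `g` must have exactly `2 ^ i` elements.
-/

/-! ### Operators between levels of the subset lattice -/

/-- The sum of `h` over the sets obtained from `x` by deleting one element. -/
def upSum {α : Type*} [DecidableEq α] (h : Finset α → ℝ) (x : Finset α) : ℝ :=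
  ∑ a ∈ x, h (x.erase a)

/-- The sum of `h` over the sets obtained from `y` by adding one element. -/
def downSum {α : Type*} [Fintype α] [DecidableEq α] (h : Finset α → ℝ) (y : Finset α) : ℝ :=
  ∑ b ∈ yᶜ, h (insert b y)

/-- The sum of `g` over the `i`-element subsets of `x`. -/
def subsetSum {α : Type*} (i : ℕ) (g : Finset α → ℝ) (x : Finset α) : ℝ :=
  ∑ I ∈ x.powersetCard i, g I

/-- A function on the `i`-element subsets of `α`, extended by zero to all finite sets, whose sum over
the `i`-sets containing any given `(i - 1)`-set vanishes. -/
structure IsNullDesign {α : Type*} [Fintype α] [DecidableEq α] (i : ℕ) (g : Finset α → ℝ) :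
    Prop where
  card_of_ne_zero : ∀ I, g I ≠ 0 → I.card = i
  downSum_eq_zero : ∀ C : Finset α, C.card + 1 = i → downSum g C = 0

section Operators

variable {α : Type*} [DecidableEq α]

/-- Each `i`-subset of `x` is counted once for every element of `x` outside it. -/
theorem upSum_subsetSum (i : ℕ) (g : Finset α → ℝ) (x : Finset α) :
    upSum (subsetSum i g) x = ((x.card : ℝ) - i) * subsetSum i g x := by
  have h1 : ∀ a ∈ x, subsetSum i g (x.erase a) =
      ∑ I ∈ x.powersetCard i, if a ∉ I then g I else 0 := by
    intro a _
    rw [← Finset.sum_filter, subsetSum]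
    apply Finset.sum_congr _ fun _ _ => rfl
    ext I
    simp only [Finset.mem_powersetCard, Finset.mem_filter, Finset.subset_erase]
    tauto
  rw [upSum, Finset.sum_congr rfl h1, Finset.sum_comm, subsetSum, Finset.mul_sum]
  refine Finset.sum_congr rfl fun I hI => ?_
  obtain ⟨hIx, hIc⟩ := Finset.mem_powersetCard.1 hI
  have h2 : x.filter (fun a => a ∉ I) = x \ I := by ext a; simp
  rw [← Finset.sum_filter, h2, Finset.sum_const, nsmul_eq_mul, Finset.card_sdiff_of_subset hIx,
    Nat.cast_sub (Finset.card_le_card hIx), hIc]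

/-- If all sums of `g` over the `i`-subsets of the `w`-subsets of an `(i + w)`-set vanish, so does
`g` on the `i`-subsets. The sums vanish on the larger sets as well, and inclusion-exclusion over the
sets obtained by removing parts of `I` recovers `g I`. -/
theorem eq_zero_of_subsetSum_eq_zero {i w : ℕ} (hiw : i ≤ w) {g : Finset α → ℝ} {V I : Finset α}
    (hV : V.card = i + w) (hI : I ⊆ V) (hIc : I.card = i)
    (h : ∀ x ⊆ V, x.card = w → subsetSum i g x = 0) : g I = 0 := by
  have hlarge : ∀ k : ℕ, ∀ x ⊆ V, x.card = w + k → subsetSum i g x = 0 := by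
    intro k
    induction k with
    | zero => exact fun x hx hxc => h x hx hxc
    | succ k ih =>
      intro x hx hxc
      have h1 := upSum_subsetSum i g x
      rw [upSum, Finset.sum_eq_zero, eq_comm, mul_eq_zero, or_iff_right] at h1
      · exact h1
      · rw [hxc, sub_eq_zero]
        norm_cast
        omega
      · intro a ha
        apply ih _ ((Finset.erase_subset a x).trans hx)
        rw [Finset.card_erase_of_mem ha, hxc]
        omega
  have h1 : ∑ E ∈ I.powerset, (-1 : ℝ) ^ E.card * subsetSum i g (V \ E) = 0 := by
    refine Finset.sum_eq_zero fun E hE => ?_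
    rw [Finset.mem_powerset] at hE
    have hEc := Finset.card_le_card hE
    rw [hlarge (i - E.card) _ Finset.sdiff_subset, mul_zero]
    rw [Finset.card_sdiff_of_subset (hE.trans hI), hV]
    omega
  have h2 : ∀ E ∈ I.powerset, (-1 : ℝ) ^ E.card * subsetSum i g (V \ E) =
      ∑ J ∈ V.powersetCard i, if E ⊆ I \ J then (-1 : ℝ) ^ E.card * g J else 0 := by
    intro E hE
    rw [Finset.mem_powerset] at hE
    rw [← Finset.sum_filter, subsetSum, Finset.mul_sum]
    refine Finset.sum_congr ?_ fun _ _ => rfl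
    ext J
    simp only [Finset.mem_powersetCard, Finset.mem_filter, Finset.subset_sdiff]
    rw [disjoint_comm (a := J)]
    tauto
  have h3 : ∀ J ∈ V.powersetCard i, (∑ E ∈ I.powerset,
      if E ⊆ I \ J then (-1 : ℝ) ^ E.card * g J else 0) = if J = I then g J else 0 := by
    intro J hJ
    have h4 : I.powerset.filter (fun E => E ⊆ I \ J) = (I \ J).powerset := by
      ext E
      simp only [Finset.mem_filter, Finset.mem_powerset]
      exact ⟨fun h => h.2, fun h => ⟨h.trans Finset.sdiff_subset, h⟩⟩
    have h5 : (∑ E ∈ (I \ J).powerset, (-1 : ℝ) ^ E.card) = if I \ J = ∅ then 1 else 0 := by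
      exact_mod_cast congrArg (Int.cast : ℤ → ℝ) (Finset.sum_powerset_neg_one_pow_card (x := I \ J))
    rw [← Finset.sum_filter, h4, ← Finset.sum_mul, h5, ite_mul, one_mul, zero_mul]
    congr 1
    rw [Finset.sdiff_eq_empty_iff_subset, eq_iff_iff]
    constructor
    · intro hIJ
      exact (Finset.eq_of_subset_of_card_le hIJ
        (by rw [hIc, (Finset.mem_powersetCard.1 hJ).2])).symm
    · rintro rfl
      exact subset_rfl
  rw [Finset.sum_congr rfl h2, Finset.sum_comm, Finset.sum_congr rfl h3,
    Finset.sum_ite_eq' , if_pos (Finset.mem_powersetCard.2 ⟨hI, hIc⟩)] at h1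
  exact h1

variable [Fintype α]

/-- `upSum` and `downSum` are adjoint to each other. -/
theorem sum_mul_upSum (k : ℕ) (f h : Finset α → ℝ) :
    ∑ x ∈ Finset.univ.powersetCard (k + 1), f x * upSum h x =
      ∑ y ∈ Finset.univ.powersetCard k, downSum f y * h y := by
  simp only [upSum, downSum, Finset.mul_sum, Finset.sum_mul]
  rw [Finset.sum_sigma', Finset.sum_sigma']
  refine Finset.sum_bij' (fun p _ => ⟨p.1.erase p.2, p.2⟩) (fun q _ => ⟨insert q.2 q.1, q.2⟩)
    ?_ ?_ ?_ ?_ ?_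
  · rintro ⟨x, a⟩ hp
    simp only [Finset.mem_sigma, Finset.mem_powersetCard, Finset.subset_univ, true_and] at hp
    simp [Finset.card_erase_of_mem hp.2, hp.1]
  · rintro ⟨y, b⟩ hq
    simp only [Finset.mem_sigma, Finset.mem_powersetCard, Finset.subset_univ, true_and,
      Finset.mem_compl] at hq
    simp [Finset.card_insert_of_notMem hq.2, hq.1]
  · rintro ⟨x, a⟩ hp
    simp only [Finset.mem_sigma] at hp
    simp [Finset.insert_erase hp.2]
  · rintro ⟨y, b⟩ hq
    simp only [Finset.mem_sigma, Finset.mem_compl] at hq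
    simp [Finset.erase_insert hq.2]
  · rintro ⟨x, a⟩ hp
    simp only [Finset.mem_sigma] at hp
    simp [Finset.insert_erase hp.2]

/-- The sum of `f` over the sets obtained from `x` by exchanging one element. -/
def exchangeSum (f : Finset α → ℝ) (x : Finset α) : ℝ :=
  ∑ a ∈ x, ∑ b ∈ xᶜ, f (insert b (x.erase a))

theorem upSum_downSum (f : Finset α → ℝ) (x : Finset α) :
    upSum (downSum f) x = x.card * f x + exchangeSum f x := by
  have h1 : ∀ a ∈ x, downSum f (x.erase a) = f x + ∑ b ∈ xᶜ, f (insert b (x.erase a)) := by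
    intro a ha
    rw [downSum, Finset.compl_erase, Finset.sum_insert (by simpa using ha),
      Finset.insert_erase ha]
  rw [upSum, Finset.sum_congr rfl h1, Finset.sum_add_distrib, Finset.sum_const, nsmul_eq_mul,
    exchangeSum]

theorem downSum_upSum (f : Finset α → ℝ) (x : Finset α) :
    downSum (upSum f) x = ((Fintype.card α : ℝ) - x.card) * f x + exchangeSum f x := by
  have h1 : ∀ b ∈ xᶜ, upSum f (insert b x) = f x + ∑ a ∈ x, f (insert b (x.erase a)) := by
    intro b hb
    rw [Finset.mem_compl] at hb
    rw [upSum, Finset.sum_insert hb, Finset.erase_insert hb]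
    congr 1
    refine Finset.sum_congr rfl fun a ha => ?_
    rw [Finset.erase_insert_of_ne]
    rintro rfl
    exact hb ha
  rw [downSum, Finset.sum_congr rfl h1, Finset.sum_add_distrib, Finset.sum_const, nsmul_eq_mul,
    exchangeSum, Finset.sum_comm, Finset.card_compl, Nat.cast_sub (Finset.card_le_univ x)]

/-- A function annihilated by `upSum ∘ downSum` on the `i`-sets is a null design, because the two
operators are adjoint to each other. -/
theorem downSum_eq_zero_of_upSum_downSum {i : ℕ} {f : Finset α → ℝ}
    (hf : ∀ x : Finset α, x.card = i → upSum (downSum f) x = 0) (C : Finset α)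
    (hC : C.card + 1 = i) : downSum f C = 0 := by
  have h := sum_mul_upSum C.card f (downSum f)
  rw [Finset.sum_eq_zero] at h
  · rw [eq_comm, Finset.sum_eq_zero_iff_of_nonneg (fun y _ => mul_self_nonneg _)] at h
    exact mul_self_eq_zero.1 (h C (by simp))
  · intro x hx
    rw [hf x (by rw [(Finset.mem_powersetCard.1 hx).2, hC]), mul_zero]

/-- The functions on the `(i + k)`-sets with the eigenvalue of index `i` are sums of a null design
over `i`-subsets: `downSum` carries the eigenspace to the corresponding one a level lower, and
`upSum` brings it back up to a nonzero factor. -/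
theorem exists_isNullDesign_subsetSum (i k : ℕ) (hn : 2 * i + k ≤ Fintype.card α)
    (f : Finset α → ℝ)
    (hf : ∀ x : Finset α, x.card = i + k → upSum (downSum f) x =
      k * ((Fintype.card α : ℝ) - 2 * i - k + 1) * f x) :
    ∃ g, IsNullDesign i g ∧ ∀ x : Finset α, x.card = i + k → f x = subsetSum i g x := by
  induction k generalizing f with
  | zero =>
    refine ⟨fun I => if I.card = i then f I else 0, ⟨fun I hI => ?_, fun C hC => ?_⟩,
      fun x hx => ?_⟩
    · by_contra h
      simp [h] at hI
    · refine (Finset.sum_congr rfl fun b hb => ?_).trans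
        (downSum_eq_zero_of_upSum_downSum (f := f) (fun x hx => by simp [hf x hx]) C hC)
      refine if_pos ?_
      rw [Finset.card_insert_of_notMem (by simpa using hb), hC]
    · rw [add_zero] at hx
      subst hx
      simp [subsetSum]
  | succ k ih =>
    set c : ℝ := ((k + 1 : ℕ) : ℝ) * ((Fintype.card α : ℝ) - 2 * i - (k + 1 : ℕ) + 1) with hc
    have hn' : ((2 * i + (k + 1) : ℕ) : ℝ) ≤ Fintype.card α := by exact_mod_cast hn
    push_cast at hn' hc
    have hc0 : c ≠ 0 := by
      rw [hc]
      apply mul_ne_zero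
      · positivity
      · linarith
    clear_value c
    obtain ⟨g, hg, hfg⟩ := ih (by omega) (downSum f) (fun y hy => by
      -- The commutation relation turns `downSum ∘ upSum` into `upSum ∘ downSum`.
      have h1 := upSum_downSum (downSum f) y
      have h2 := downSum_upSum (downSum f) y
      have h3 : downSum (upSum (downSum f)) y = c * downSum f y := by
        rw [downSum, downSum, Finset.mul_sum]
        refine Finset.sum_congr rfl fun b hb => hf _ ?_
        rw [Finset.card_insert_of_notMem (by simpa using hb), hy, add_assoc]
      rw [hy] at h1 h2
      push_cast at h1 h2
      rw [h3] at h2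
      rw [h1]
      linear_combination downSum f y * hc - h2)
    refine ⟨fun I => c⁻¹ * (k + 1) * g I, ⟨fun I hI => hg.card_of_ne_zero I
      (right_ne_zero_of_mul hI), fun C hC => ?_⟩, fun x hx => ?_⟩
    · rw [downSum, ← Finset.mul_sum]
      exact mul_eq_zero_of_right _ (hg.downSum_eq_zero C hC)
    -- `c * f x = upSum (downSum f) x`, and `upSum` multiplies `subsetSum i g` by `k + 1`.
    · have h1 := hf x hx
      have h2 : upSum (downSum f) x = upSum (subsetSum i g) x := by
        refine Finset.sum_congr rfl fun a ha => hfg _ ?_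
        rw [Finset.card_erase_of_mem ha, hx]
        omega
      rw [h2, upSum_subsetSum, hx] at h1
      rw [subsetSum, ← Finset.mul_sum]
      change f x = c⁻¹ * (k + 1) * subsetSum i g x
      field_simp
      rw [mul_comm, ← h1]
      push_cast
      ring

end Operators

/-! ### Null designs and their minimal supports -/

section NullDesigns

variable {α : Type*} [DecidableEq α] [Fintype α] {i : ℕ} {g : Finset α → ℝ}

/-- Each set `J` of the support that contains `C` is counted once for every element of `J \ C`. -/
theorem sum_compl_sum_superset (hg : IsNullDesign i g) (C : Finset α) :
    ∑ b ∈ Cᶜ, ∑ J with insert b C ⊆ J, g J = ((i : ℝ) - C.card) * ∑ J with C ⊆ J, g J := by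
  simp only [Finset.sum_filter]
  rw [Finset.sum_comm, Finset.mul_sum]
  refine Finset.sum_congr rfl fun J _ => ?_
  by_cases hJ : g J = 0
  · simp [hJ]
  by_cases hC : C ⊆ J
  · have h1 : Cᶜ.filter (fun b => insert b C ⊆ J) = J \ C := by
      ext b
      simp only [Finset.mem_filter, Finset.mem_compl, Finset.insert_subset_iff, Finset.mem_sdiff]
      tauto
    rw [if_pos hC, ← Finset.sum_filter, h1, Finset.sum_const, nsmul_eq_mul,
      Finset.card_sdiff_of_subset hC, Nat.cast_sub (Finset.card_le_card hC),
      hg.card_of_ne_zero J hJ]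
  · rw [if_neg hC, mul_zero]
    refine Finset.sum_eq_zero fun b _ => if_neg fun h => hC ((Finset.subset_insert b C).trans h)

theorem sum_superset_of_card_eq (hg : IsNullDesign i g) {I : Finset α} (hI : I.card = i) :
    ∑ J with I ⊆ J, g J = g I := by
  rw [Finset.sum_filter, Finset.sum_eq_single I]
  · simp
  · intro J _ hJI
    by_cases hJ : g J = 0
    · simp [hJ]
    · refine if_neg fun h => hJI ?_
      exact (Finset.eq_of_subset_of_card_le h (by rw [hg.card_of_ne_zero J hJ, hI])).symm
  · simp

/-- A null design sums to zero over the sets containing any given set of fewer than `i` elements,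
not only over those containing an `(i - 1)`-set. -/
theorem sum_superset_eq_zero (hg : IsNullDesign i g) (d : ℕ) {C : Finset α}
    (hC : C.card + (d + 1) = i) : ∑ J with C ⊆ J, g J = 0 := by
  induction d generalizing C with
  | zero =>
    have h := sum_compl_sum_superset hg C
    have h1 : ∀ b ∈ Cᶜ, ∑ J with insert b C ⊆ J, g J = g (insert b C) := fun b hb =>
      sum_superset_of_card_eq hg (by rw [Finset.card_insert_of_notMem (by simpa using hb), ← hC])
    rw [Finset.sum_congr rfl h1, ← downSum, hg.downSum_eq_zero C hC, ← hC] at h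
    simpa using h.symm
  | succ d ih =>
    have h := sum_compl_sum_superset hg C
    rw [Finset.sum_eq_zero, eq_comm, mul_eq_zero, or_iff_right] at h
    · exact h
    · rw [sub_eq_zero]
      norm_cast
      omega
    · intro b hb
      apply ih
      rw [Finset.card_insert_of_notMem (by simpa using hb)]
      omega

/-- The values of a null design on the sets with a given trace on `I` sum to `± g I`, by
inclusion-exclusion. -/
theorem sum_inter_eq (hg : IsNullDesign i g) {I C : Finset α} (hI : I.card = i) (hC : C ⊆ I) :
    ∑ J with J ∩ I = C, g J = (-1) ^ (I \ C).card * g I := by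
  have h1 : ∑ E ∈ (I \ C).powerset, (-1 : ℝ) ^ E.card * ∑ J with C ∪ E ⊆ J, g J =
      (-1) ^ (I \ C).card * g I := by
    rw [Finset.sum_eq_single (I \ C)]
    · rw [Finset.union_sdiff_of_subset hC, sum_superset_of_card_eq hg hI]
    · intro E hE hne
      rw [Finset.mem_powerset] at hE
      have h2 : C ∪ E ⊂ I := by
        refine (Finset.union_subset hC (hE.trans Finset.sdiff_subset)).ssubset_of_ne ?_
        rintro h
        apply hne
        rw [← h, Finset.union_sdiff_left, eq_comm, Finset.sdiff_eq_self_iff_disjoint]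
        exact Finset.disjoint_of_subset_left hE Finset.sdiff_disjoint
      have h3 := Finset.card_lt_card h2
      rw [sum_superset_eq_zero hg (i - (C ∪ E).card - 1) (by omega), mul_zero]
    · intro h
      simp at h
  rw [← h1]
  simp only [Finset.sum_filter, Finset.mul_sum]
  rw [Finset.sum_comm]
  refine Finset.sum_congr rfl fun J _ => ?_
  by_cases hCJ : C ⊆ J
  · have h2 : (I \ C).powerset.filter (fun E => C ∪ E ⊆ J) = ((I \ C) ∩ J).powerset := by
      ext E
      simp only [Finset.mem_filter, Finset.mem_powerset, Finset.union_subset_iff,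
        Finset.subset_inter_iff]
      tauto
    have h3 : (∑ E ∈ ((I \ C) ∩ J).powerset, (-1 : ℝ) ^ E.card) =
        if (I \ C) ∩ J = ∅ then 1 else 0 := by
      exact_mod_cast congrArg (Int.cast : ℤ → ℝ)
        (Finset.sum_powerset_neg_one_pow_card (x := (I \ C) ∩ J))
    simp only [mul_ite, mul_zero]
    rw [← Finset.sum_filter, h2, ← Finset.sum_mul, h3, ite_mul, one_mul, zero_mul]
    congr 1
    rw [eq_iff_iff]
    simp only [Finset.ext_iff, Finset.mem_inter, Finset.mem_sdiff, Finset.notMem_empty, iff_false]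
    constructor
    · intro h x hx
      exact hx.1.2 ((h x).1 ⟨hx.2, hx.1.1⟩)
    · intro h x
      refine ⟨fun hx => ?_, fun hx => ⟨hCJ hx, hC hx⟩⟩
      by_contra hxC
      exact h x ⟨⟨hx.2, hxC⟩, hx.1⟩
  · rw [if_neg, eq_comm]
    · refine Finset.sum_eq_zero fun E _ => ?_
      rw [if_neg, mul_zero]
      exact fun h => hCJ (Finset.subset_union_left.trans h)
    · rintro rfl
      exact hCJ Finset.inter_subset_left

theorem exists_ne_zero_inter_eq (hg : IsNullDesign i g) {I C : Finset α} (hI : g I ≠ 0)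
    (hC : C ⊆ I) : ∃ J, g J ≠ 0 ∧ J ∩ I = C := by
  have h := sum_inter_eq hg (hg.card_of_ne_zero I hI) hC
  obtain ⟨J, hJ, hJ0⟩ := Finset.exists_ne_zero_of_sum_ne_zero
    (h ▸ mul_ne_zero (pow_ne_zero _ (by norm_num)) hI)
  exact ⟨J, hJ0, (Finset.mem_filter.1 hJ).2⟩

theorem surjOn_inter (hg : IsNullDesign i g) {I : Finset α} (hI : g I ≠ 0) :
    Set.SurjOn (fun J => J ∩ I) (Finset.univ.filter fun J => g J ≠ 0) I.powerset := by
  intro C hC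
  obtain ⟨J, hJ, hJC⟩ := exists_ne_zero_inter_eq hg hI (Finset.mem_powerset.1 hC)
  exact ⟨J, by simpa using hJ, hJC⟩

theorem two_pow_le_card_support (hg : IsNullDesign i g) {I : Finset α} (hI : g I ≠ 0) :
    2 ^ i ≤ (Finset.univ.filter fun J => g J ≠ 0).card := by
  rw [← hg.card_of_ne_zero I hI, ← Finset.card_powerset]
  exact Finset.card_le_card_of_surjOn _ (surjOn_inter hg hI)

/-- When the support has only `2 ^ i` elements, its `2 ^ i` traces on `I` are all distinct. -/
theorem inter_injOn_of_card_support (hg : IsNullDesign i g)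
    (hS : (Finset.univ.filter fun J => g J ≠ 0).card ≤ 2 ^ i) {I J K : Finset α}
    (hI : g I ≠ 0) (hJ : g J ≠ 0) (hK : g K ≠ 0) (h : J ∩ I = K ∩ I) : J = K :=
  Finset.injOn_of_surjOn_of_card_le (fun J => J ∩ I)
    (t := I.powerset) (fun _ _ => by simp) (surjOn_inter hg hI)
    (by rwa [Finset.card_powerset, hg.card_of_ne_zero I hI]) (by simpa using hJ)
    (by simpa using hK) h

/-- When the support has only `2 ^ i` elements, the sum in `sum_inter_eq` has a single nonzero
term. -/
theorem eq_neg_one_pow_mul_of_card_support (hg : IsNullDesign i g)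
    (hS : (Finset.univ.filter fun J => g J ≠ 0).card ≤ 2 ^ i) {I J : Finset α}
    (hI : g I ≠ 0) (hJ : g J ≠ 0) : g J = (-1) ^ (I \ J).card * g I := by
  have h := sum_inter_eq hg (hg.card_of_ne_zero I hI) (Finset.inter_subset_right (s₁ := J))
  rw [Finset.inter_comm J I, Finset.sdiff_inter_self_left] at h
  rw [← h, Finset.sum_filter, Finset.sum_eq_single J]
  · rw [if_pos (Finset.inter_comm J I)]
  · intro K _ hKJ
    by_cases hK : g K = 0
    · simp [hK]
    · refine if_neg fun hKI => hKJ ?_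
      exact inter_injOn_of_card_support hg hS hI hK hJ (by rw [hKI, Finset.inter_comm])
  · simp

/-- In a null design of minimal support, the set `J` of the support that arises from `I` by
exchanging `a` for `a'` forces every set of the support to contain exactly one of `a` and `a'`:
the signs of the values on `I` and on `J` are opposite. -/
theorem mem_iff_notMem_of_card_support (hg : IsNullDesign i g)
    (hS : (Finset.univ.filter fun J => g J ≠ 0).card ≤ 2 ^ i) {I K : Finset α} {a a' : α}
    (hI : g I ≠ 0) (ha : a ∈ I) (ha' : a' ∉ I) (hJ : g (insert a' (I.erase a)) ≠ 0)
    (hK : g K ≠ 0) : a ∈ K ↔ a' ∉ K := by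
  have haa' : a ≠ a' := fun h => ha' (h ▸ ha)
  have ha1 : a ∉ I.erase a := by simp
  have ha2 : a' ∉ I.erase a := by simp [ha']
  have h1 := eq_neg_one_pow_mul_of_card_support hg hS hI hK
  rw [eq_neg_one_pow_mul_of_card_support hg hS hJ hK,
    eq_neg_one_pow_mul_of_card_support hg hS hI hJ] at h1
  have h2 : I \ insert a' (I.erase a) = {a} := by
    ext x
    simp only [Finset.mem_sdiff, Finset.mem_insert, Finset.mem_erase, Finset.mem_singleton]
    constructor
    · tauto
    · rintro rfl
      simp [ha, haa']
  rw [h2, Finset.card_singleton, ← mul_assoc] at h1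
  have h3 := mul_right_cancel₀ hI h1
  have h4 : I = insert a (I.erase a) := (Finset.insert_erase ha).symm
  rw [h4, Finset.erase_insert ha1] at h3
  by_cases hk : a ∈ K <;> by_cases hk' : a' ∈ K
  · exfalso
    rw [Finset.insert_sdiff_of_mem _ hk, Finset.insert_sdiff_of_mem _ hk'] at h3
    rcases neg_one_pow_eq_or ℝ (I.erase a \ K).card with h | h <;> rw [h] at h3 <;> norm_num at h3
  · tauto
  · tauto
  · exfalso
    rw [Finset.insert_sdiff_of_notMem _ hk, Finset.insert_sdiff_of_notMem _ hk',
      Finset.card_insert_of_notMem (by simp [ha']), Finset.card_insert_of_notMem (by simp),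
      pow_succ] at h3
    rcases neg_one_pow_eq_or ℝ (I.erase a \ K).card with h | h <;> rw [h] at h3 <;> norm_num at h3

end NullDesigns

/-! ### The alternating product of a pairing -/

namespace CoordinatePairing

variable {n i : ℕ} (P : CoordinatePairing n i)

/-- The set `x` contains exactly one element of each pair `{m, m'}`. -/
def IsTransversal (x : Finset (Fin n)) : Prop := ∀ m ∈ P.M, m ∈ x ↔ P.prime m ∉ x

/-- The product over `m ∈ M` of the differences `x_{m'} - x_m` of the coordinates of the binary
vector with support `x`. -/
def altProd (x : Finset (Fin n)) : ℝ :=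
  ∏ m ∈ P.M, ((if P.prime m ∈ x then 1 else 0) - (if m ∈ x then 1 else 0))

theorem prime_mem {m : Fin n} (hm : m ∈ P.M) : P.prime m ∈ P.M' := P.bijOn.mapsTo hm

theorem prime_notMem {m : Fin n} (hm : m ∈ P.M) : P.prime m ∉ P.M :=
  Finset.disjoint_right.1 P.disjoint (P.prime_mem hm)

theorem prime_inj {m k : Fin n} (hm : m ∈ P.M) (hk : k ∈ P.M) (h : P.prime m = P.prime k) :
    m = k := P.bijOn.injOn hm hk h

theorem exists_prime_eq {b : Fin n} (hb : b ∈ P.M') : ∃ m ∈ P.M, P.prime m = b :=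
  P.bijOn.surjOn hb

theorem isTransversal_iff (x : Finset (Fin n)) : P.IsTransversal x ↔
    (x ∩ (P.M ∪ P.M')).card = i ∧ (x ∩ P.M).image P.prime ∪ (x ∩ P.M') = P.M' := by
  have hinj : Set.InjOn P.prime (x ∩ P.M : Finset (Fin n)) := fun a ha b hb h =>
    P.prime_inj (Finset.mem_inter.1 ha).2 (Finset.mem_inter.1 hb).2 h
  have hcard : (x ∩ (P.M ∪ P.M')).card =
      ((x ∩ P.M).image P.prime).card + (x ∩ P.M').card := by
    rw [Finset.card_image_of_injOn hinj, Finset.inter_union_distrib_left,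
      Finset.card_union_of_disjoint]
    exact Finset.disjoint_of_subset_left Finset.inter_subset_right
      (Finset.disjoint_of_subset_right Finset.inter_subset_right P.disjoint)
  have hmem : ∀ m ∈ P.M, P.prime m ∈ (x ∩ P.M).image P.prime ↔ m ∈ x := by
    intro m hm
    rw [Finset.mem_image]
    constructor
    · rintro ⟨k, hk, hkm⟩
      rw [Finset.mem_inter] at hk
      exact P.prime_inj hk.2 hm hkm ▸ hk.1
    · exact fun h => ⟨m, Finset.mem_inter.2 ⟨h, hm⟩, rfl⟩
  rw [hcard]
  constructor
  · intro h
    have hunion : (x ∩ P.M).image P.prime ∪ (x ∩ P.M') = P.M' := by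
      ext b
      rw [Finset.mem_union, Finset.mem_inter]
      constructor
      · rintro (hb | hb)
        · obtain ⟨m, hm, rfl⟩ := Finset.mem_image.1 hb
          exact P.prime_mem (Finset.mem_inter.1 hm).2
        · exact hb.2
      · intro hb
        obtain ⟨m, hm, rfl⟩ := P.exists_prime_eq hb
        rw [hmem m hm]
        have := h m hm
        tauto
    refine ⟨?_, hunion⟩
    rw [← Finset.card_union_of_disjoint, hunion, P.card_M']
    rw [Finset.disjoint_left]
    intro b hb hb'
    rw [Finset.mem_inter] at hb'
    obtain ⟨m, hm, rfl⟩ := P.exists_prime_eq hb'.2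
    exact (h m hm).1 ((hmem m hm).1 hb) hb'.1
  · rintro ⟨hc, hunion⟩ m hm
    have hdisj : Disjoint ((x ∩ P.M).image P.prime) (x ∩ P.M') := by
      rw [← Finset.card_union_eq_card_add_card, hunion, hc, P.card_M']
    have hm' := P.prime_mem hm
    constructor
    · intro hmx hmx'
      exact Finset.disjoint_left.1 hdisj ((hmem m hm).2 hmx) (Finset.mem_inter.2 ⟨hmx', hm'⟩)
    · intro hmx'
      rw [← hunion, Finset.mem_union, hmem m hm, Finset.mem_inter] at hm'
      tauto

theorem altProd_of_isTransversal {x : Finset (Fin n)} (hx : P.IsTransversal x) :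
    P.altProd x = (-1) ^ (P.M ∩ x).card := by
  rw [altProd, ← Finset.filter_mem_eq_inter, ← Finset.prod_const, Finset.prod_filter]
  refine Finset.prod_congr rfl fun m hm => ?_
  have := hx m hm
  by_cases h : m ∈ x
  · simp [h, this.1 h]
  · simp [h, not_not.1 (fun h' => h (this.2 h'))]

theorem altProd_of_not_isTransversal {x : Finset (Fin n)} (hx : ¬ P.IsTransversal x) :
    P.altProd x = 0 := by
  simp only [IsTransversal, not_forall] at hx
  obtain ⟨m, hm, h⟩ := hx
  refine Finset.prod_eq_zero hm ?_
  by_cases h1 : m ∈ x <;> by_cases h2 : P.prime m ∈ x <;> simp [h1, h2] at h ⊢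

theorem altProd_ne_zero_iff {x : Finset (Fin n)} : P.altProd x ≠ 0 ↔ P.IsTransversal x := by
  constructor
  · intro h
    by_contra h'
    exact h (P.altProd_of_not_isTransversal h')
  · intro h
    rw [P.altProd_of_isTransversal h]
    exact pow_ne_zero _ (by norm_num)

theorem toFun_eq_altProd (w : ℕ) (x : JohnsonVertex n w) : P.toFun w x = P.altProd x.1 := by
  rw [toFun]
  split_ifs with h
  · rw [P.altProd_of_isTransversal ((P.isTransversal_iff _).2 h)]
  · rw [P.altProd_of_not_isTransversal (fun h' => h ((P.isTransversal_iff _).1 h'))]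

theorem altProd_congr {x y : Finset (Fin n)} (h : ∀ a ∈ P.M ∪ P.M', a ∈ x ↔ a ∈ y) :
    P.altProd x = P.altProd y := by
  refine Finset.prod_congr rfl fun m hm => ?_
  simp only [h m (Finset.mem_union_left _ hm),
    h (P.prime m) (Finset.mem_union_right _ (P.prime_mem hm))]

/-- Changing the coordinates `m` and `m'` affects only one factor of the product. -/
theorem altProd_add_eq_zero {x y : Finset (Fin n)} {m : Fin n} (hm : m ∈ P.M)
    (hmx : m ∈ x) (hmx' : P.prime m ∉ x) (hmy : m ∉ y) (hmy' : P.prime m ∈ y)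
    (h : ∀ a, a ≠ m → a ≠ P.prime m → (a ∈ x ↔ a ∈ y)) : P.altProd x + P.altProd y = 0 := by
  rw [altProd, altProd, ← Finset.mul_prod_erase _ _ hm, ← Finset.mul_prod_erase _ _ hm]
  have h1 : ∀ k ∈ P.M.erase m,
      ((if P.prime k ∈ x then (1 : ℝ) else 0) - (if k ∈ x then 1 else 0)) =
      ((if P.prime k ∈ y then 1 else 0) - (if k ∈ y then 1 else 0)) := by
    intro k hk
    obtain ⟨hkm, hk⟩ := Finset.mem_erase.1 hk
    have h2 : k ≠ P.prime m := fun h => P.prime_notMem hm (h ▸ hk)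
    have h3 : P.prime k ≠ m := fun h => P.prime_notMem hk (h.symm ▸ hm)
    have h4 : P.prime k ≠ P.prime m := fun h => hkm (P.prime_inj hk hm h)
    simp only [h k hkm h2, h _ h3 h4]
  rw [Finset.prod_congr rfl h1]
  simp [hmx, hmx', hmy, hmy']

theorem altProd_eq_zero_of_iff {x : Finset (Fin n)} {m : Fin n} (hm : m ∈ P.M)
    (h : m ∈ x ↔ P.prime m ∈ x) : P.altProd x = 0 := by
  refine P.altProd_of_not_isTransversal fun hx => ?_
  have := hx m hm
  tauto

theorem card_inter_of_isTransversal {x : Finset (Fin n)} (hx : P.IsTransversal x) :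
    (x ∩ (P.M ∪ P.M')).card = i := ((P.isTransversal_iff x).1 hx).1

/-- Deleting an element outside `M ∪ M'` does not change the product, deleting one from a
transversal kills it, and the two deletions from a full pair `{m, m'}` cancel. -/
theorem upSum_altProd (x : Finset (Fin n)) :
    upSum P.altProd x = ((x.card : ℝ) - i) * P.altProd x := by
  by_cases hx : P.IsTransversal x
  · have h1 : ∀ a ∈ x, P.altProd (x.erase a) = if a ∈ x \ (P.M ∪ P.M') then P.altProd x else 0 := by
      intro a ha
      split_ifs with h
      · apply P.altProd_congr
        intro b hb
        rw [Finset.mem_erase]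
        refine ⟨fun h => h.2, fun hbx => ⟨?_, hbx⟩⟩
        rintro rfl
        exact (Finset.mem_sdiff.1 h).2 hb
      · have h2 : a ∈ P.M ∪ P.M' := by
          by_contra h2
          exact h (Finset.mem_sdiff.2 ⟨ha, h2⟩)
        rw [Finset.mem_union] at h2
        rcases h2 with h2 | h2
        · apply P.altProd_eq_zero_of_iff h2
          have := hx a h2
          simp [Finset.mem_erase]
          tauto
        · obtain ⟨m, hm, rfl⟩ := P.exists_prime_eq h2
          apply P.altProd_eq_zero_of_iff hm
          have := hx m hm
          simp [Finset.mem_erase]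
          tauto
    have h2 : x.filter (fun a => a ∈ x \ (P.M ∪ P.M')) = x \ (P.M ∪ P.M') := by
      ext a
      simp only [Finset.mem_filter, Finset.mem_sdiff]
      tauto
    have h3 := Finset.card_sdiff_add_card_inter x (P.M ∪ P.M')
    rw [P.card_inter_of_isTransversal hx] at h3
    rw [upSum, Finset.sum_congr rfl h1, ← Finset.sum_filter, h2, Finset.sum_const, nsmul_eq_mul,
      ← h3]
    push_cast
    ring
  · rw [P.altProd_of_not_isTransversal hx, mul_zero]
    simp only [IsTransversal, not_forall] at hx
    obtain ⟨m, hm, hmx⟩ := hx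
    have hne : m ≠ P.prime m := fun h => P.prime_notMem hm (h ▸ hm)
    by_cases h : m ∈ x
    · have h' : P.prime m ∈ x := by tauto
      rw [upSum, ← Finset.add_sum_erase _ _ h,
        ← Finset.add_sum_erase _ _ (Finset.mem_erase.2 ⟨hne.symm, h'⟩), ← add_assoc,
        Finset.sum_eq_zero, add_zero, add_comm]
      · refine P.altProd_add_eq_zero hm ?_ ?_ ?_ ?_ ?_
        · simp [h, hne]
        · simp
        · simp
        · simp [h', hne.symm]
        · intro a ha ha'
          simp [ha, ha']
      · intro a ha
        simp only [Finset.mem_erase] at ha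
        apply P.altProd_eq_zero_of_iff hm
        simp [h, h', Ne.symm ha.1, Ne.symm ha.2.1]
    · have h' : P.prime m ∉ x := by tauto
      refine Finset.sum_eq_zero fun a _ => P.altProd_eq_zero_of_iff hm ?_
      simp [h, h']

/-- Adding an element outside `M ∪ M'` does not change the product, adding one from `M ∪ M'` to a
transversal kills it, and the two ways to add an element of an empty pair `{m, m'}` cancel. -/
theorem downSum_altProd (y : Finset (Fin n)) :
    downSum P.altProd y = ((n : ℝ) - y.card - i) * P.altProd y := by
  by_cases hy : P.IsTransversal y
  · have h1 : ∀ b ∈ yᶜ, P.altProd (insert b y) =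
        if b ∉ y ∪ (P.M ∪ P.M') then P.altProd y else 0 := by
      intro b hb
      rw [Finset.mem_compl] at hb
      split_ifs with h
      · have h2 : b ∈ P.M ∪ P.M' := by
          rw [Finset.mem_union] at h
          exact h.resolve_left hb
        rw [Finset.mem_union] at h2
        rcases h2 with h2 | h2
        · apply P.altProd_eq_zero_of_iff h2
          have := hy b h2
          simp [Finset.mem_insert]
          tauto
        · obtain ⟨m, hm, rfl⟩ := P.exists_prime_eq h2
          apply P.altProd_eq_zero_of_iff hm
          have := hy m hm
          simp [Finset.mem_insert]
          tauto
      · apply P.altProd_congr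
        intro a ha
        rw [Finset.mem_insert]
        refine ⟨fun h' => h'.resolve_left ?_, Or.inr⟩
        rintro rfl
        exact h (Finset.mem_union_right _ ha)
    have h2 : yᶜ.filter (fun b => b ∉ y ∪ (P.M ∪ P.M')) = (y ∪ (P.M ∪ P.M'))ᶜ := by
      ext b
      simp only [Finset.mem_filter, Finset.mem_compl, Finset.mem_union]
      tauto
    have h3 := Finset.card_union_add_card_inter y (P.M ∪ P.M')
    rw [P.card_inter_of_isTransversal hy, Finset.card_union_of_disjoint P.disjoint, P.card_M,
      P.card_M'] at h3
    have h4 : ((y ∪ (P.M ∪ P.M')).card : ℝ) + i = y.card + (i + i) := by exact_mod_cast h3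
    rw [downSum, Finset.sum_congr rfl h1, ← Finset.sum_filter, h2, Finset.sum_const, nsmul_eq_mul,
      Finset.card_compl, Nat.cast_sub (Finset.card_le_univ _), Fintype.card_fin]
    congr 1
    linarith
  · rw [P.altProd_of_not_isTransversal hy, mul_zero]
    simp only [IsTransversal, not_forall] at hy
    obtain ⟨m, hm, hmy⟩ := hy
    have hne : m ≠ P.prime m := fun h => P.prime_notMem hm (h ▸ hm)
    by_cases h : m ∈ y
    · have h' : P.prime m ∈ y := by tauto
      refine Finset.sum_eq_zero fun a _ => P.altProd_eq_zero_of_iff hm ?_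
      simp [h, h']
    · have h' : P.prime m ∉ y := by tauto
      rw [downSum, ← Finset.add_sum_erase _ _ (Finset.mem_compl.2 h),
        ← Finset.add_sum_erase _ _ (Finset.mem_erase.2 ⟨hne.symm, Finset.mem_compl.2 h'⟩),
        ← add_assoc, Finset.sum_eq_zero, add_zero]
      · refine P.altProd_add_eq_zero hm ?_ ?_ ?_ ?_ ?_
        · simp
        · simp [h', hne.symm]
        · simp [h, hne]
        · simp
        · intro a ha ha'
          simp [ha, ha']
      · intro a ha
        simp only [Finset.mem_erase] at ha
        apply P.altProd_eq_zero_of_iff hm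
        simp [h, h', Ne.symm ha.1, Ne.symm ha.2.1]

/-- As functions of level `i + k`, both sides are multiplied by `k + 1` when `upSum` carries them to
the next level, and they agree on level `i`. -/
theorem subsetSum_altProd (k : ℕ) (x : Finset (Fin n)) (hx : x.card = i + k) :
    subsetSum i P.altProd x = P.altProd x := by
  induction k generalizing x with
  | zero =>
    rw [add_zero] at hx
    have h1 : x.powersetCard i = {x} := hx ▸ Finset.powersetCard_self x
    rw [subsetSum, h1, Finset.sum_singleton]
  | succ k ih =>
    have h1 : upSum (subsetSum i P.altProd) x = upSum P.altProd x := by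
      refine Finset.sum_congr rfl fun a ha => ih _ ?_
      rw [Finset.card_erase_of_mem ha, hx]
      omega
    rw [upSum_subsetSum, upSum_altProd] at h1
    refine mul_left_cancel₀ ?_ h1
    rw [hx, sub_ne_zero]
    norm_cast
    omega

open Classical in
/-- A transversal is determined by its trace on `M` and its part outside `M ∪ M'`, both of which
are arbitrary. -/
theorem card_isTransversal (k : ℕ) :
    ((Finset.univ.powersetCard (i + k)).filter P.IsTransversal).card =
      2 ^ i * (n - 2 * i).choose k := by
  have hR : (P.M ∪ P.M')ᶜ.card = n - 2 * i := by
    rw [Finset.card_compl, Finset.card_union_of_disjoint P.disjoint, P.card_M, P.card_M',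
      Fintype.card_fin, two_mul]
  have hM : P.M.powerset.card = 2 ^ i := by rw [Finset.card_powerset, P.card_M]
  rw [← hR, ← Finset.card_powersetCard, ← hM, ← Finset.card_product]
  have key : ∀ T ⊆ P.M, ∀ Z ⊆ (P.M ∪ P.M')ᶜ,
      (∀ m ∈ P.M, m ∈ T ∪ (P.M \ T).image P.prime ∪ Z ↔ m ∈ T) ∧
      (∀ m ∈ P.M, P.prime m ∈ T ∪ (P.M \ T).image P.prime ∪ Z ↔ m ∉ T) ∧
      (∀ a, a ∈ (T ∪ (P.M \ T).image P.prime ∪ Z) \ (P.M ∪ P.M') ↔ a ∈ Z) := by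
    intro T hT Z hZ
    have hZ' : ∀ a ∈ Z, a ∉ P.M ∧ a ∉ P.M' := by
      intro a ha
      have := hZ ha
      simpa using this
    refine ⟨?_, ?_, ?_⟩
    · intro m hm
      simp only [Finset.mem_union, Finset.mem_image, Finset.mem_sdiff]
      refine ⟨?_, fun h => Or.inl (Or.inl h)⟩
      rintro ((h | ⟨k, hk, rfl⟩) | h)
      · exact h
      · exact absurd hm (P.prime_notMem hk.1)
      · exact absurd hm (hZ' m h).1
    · intro m hm
      simp only [Finset.mem_union, Finset.mem_image, Finset.mem_sdiff]
      refine ⟨?_, fun h => Or.inl (Or.inr ⟨m, ⟨hm, h⟩, rfl⟩)⟩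
      rintro ((h | ⟨k, hk, hkm⟩) | h)
      · exact absurd (hT h) (P.prime_notMem hm)
      · exact P.prime_inj hk.1 hm hkm ▸ hk.2
      · exact absurd (P.prime_mem hm) (hZ' _ h).2
    · intro a
      simp only [Finset.mem_union, Finset.mem_image, Finset.mem_sdiff]
      constructor
      · rintro ⟨(h | ⟨k, hk, rfl⟩) | h, ha⟩
        · exact absurd (Or.inl (hT h)) ha
        · exact absurd (Or.inr (P.prime_mem hk.1)) ha
        · exact h
      · intro h
        refine ⟨Or.inr h, ?_⟩
        have := hZ' a h
        tauto
  have htr : ∀ T ⊆ P.M, ∀ Z ⊆ (P.M ∪ P.M')ᶜ,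
      P.IsTransversal (T ∪ (P.M \ T).image P.prime ∪ Z) := by
    intro T hT Z hZ m hm
    obtain ⟨h1, h2, -⟩ := key T hT Z hZ
    rw [h1 m hm, h2 m hm, not_not]
  symm
  refine Finset.card_nbij' (fun p => p.1 ∪ (P.M \ p.1).image P.prime ∪ p.2)
    (fun x => (x ∩ P.M, x \ (P.M ∪ P.M'))) ?_ ?_ ?_ ?_
  · rintro ⟨T, Z⟩ hp
    simp only [Finset.coe_product, Set.mem_prod, Finset.mem_coe, Finset.mem_powerset,
      Finset.mem_powersetCard] at hp
    simp only [Finset.mem_coe, Finset.mem_filter, Finset.mem_powersetCard, Finset.subset_univ,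
      true_and]
    have h1 := htr T hp.1 Z hp.2.1
    refine ⟨?_, h1⟩
    rw [← Finset.card_sdiff_add_card_inter _ (P.M ∪ P.M'), P.card_inter_of_isTransversal h1,
      Finset.ext (key T hp.1 Z hp.2.1).2.2, hp.2.2, add_comm]
  · intro x hx
    simp only [Finset.mem_coe, Finset.mem_filter, Finset.mem_powersetCard, Finset.subset_univ,
      true_and] at hx
    simp only [Finset.coe_product, Set.mem_prod, Finset.mem_coe, Finset.mem_powerset,
      Finset.mem_powersetCard]
    refine ⟨Finset.inter_subset_right, fun a ha => ?_, ?_⟩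
    · exact Finset.mem_compl.2 (Finset.mem_sdiff.1 ha).2
    · have h3 := Finset.card_sdiff_add_card_inter x (P.M ∪ P.M')
      rw [P.card_inter_of_isTransversal hx.2, hx.1] at h3
      omega
  · rintro ⟨T, Z⟩ hp
    simp only [Finset.coe_product, Set.mem_prod, Finset.mem_coe, Finset.mem_powerset,
      Finset.mem_powersetCard] at hp
    obtain ⟨h1, -, h3⟩ := key T hp.1 Z hp.2.1
    refine Prod.ext ?_ (Finset.ext h3)
    ext a
    rw [Finset.mem_inter]
    exact ⟨fun h => (h1 a h.2).1 h.1, fun h => ⟨(h1 a (hp.1 h)).2 h, hp.1 h⟩⟩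
  · intro x hx
    simp only [Finset.mem_coe, Finset.mem_filter] at hx
    have hx2 := hx.2
    obtain ⟨h1, h2, h3⟩ := key (x ∩ P.M) Finset.inter_subset_right (x \ (P.M ∪ P.M'))
      (fun a ha => Finset.mem_compl.2 (Finset.mem_sdiff.1 ha).2)
    ext a
    by_cases ha : a ∈ P.M
    · rw [h1 a ha, Finset.mem_inter]
      tauto
    by_cases ha' : a ∈ P.M'
    · obtain ⟨m, hm, rfl⟩ := P.exists_prime_eq ha'
      rw [h2 m hm, Finset.mem_inter]
      have := hx2 m hm
      tauto
    · have := h3 a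
      simp only [Finset.mem_sdiff, Finset.mem_union] at this ⊢
      tauto

end CoordinatePairing

/-! ### Uniqueness of null designs of minimal support -/

/-- A null design of minimal support is a multiple of the alternating product of a pairing. For
`I` in the support, `a'` is the element that replaces `a ∈ I` in the unique set of the support
meeting `I` in `I \ {a}`. -/
theorem exists_eq_altProd_of_card_support {n i : ℕ} {g : Finset (Fin n) → ℝ}
    (hg : IsNullDesign i g) (hS : (Finset.univ.filter fun J => g J ≠ 0).card ≤ 2 ^ i)
    {I : Finset (Fin n)} (hI : g I ≠ 0) :
    ∃ (P : CoordinatePairing n i) (c : ℝ), c ≠ 0 ∧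
      ∀ J : Finset (Fin n), J.card = i → g J = c * P.altProd J := by
  have hIc := hg.card_of_ne_zero I hI
  have hex : ∀ a ∈ I, ∃ a' ∉ I, g (insert a' (I.erase a)) ≠ 0 := by
    intro a ha
    obtain ⟨J, hJ, hJI⟩ := exists_ne_zero_inter_eq hg hI (Finset.erase_subset a I)
    have h1 := Finset.card_sdiff_add_card_inter J I
    rw [hJI, hg.card_of_ne_zero J hJ, Finset.card_erase_of_mem ha, hIc] at h1
    have h2 := Finset.card_pos.2 ⟨a, ha⟩
    obtain ⟨a', ha'⟩ := Finset.card_eq_one.1 (show (J \ I).card = 1 by omega)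
    have h3 : a' ∈ J \ I := by simp [ha']
    refine ⟨a', (Finset.mem_sdiff.1 h3).2, ?_⟩
    rwa [← hJI, ← Finset.singleton_union, ← ha', Finset.sdiff_union_inter]
  choose! p hpI hpg using hex
  have htrans : ∀ K, g K ≠ 0 → ∀ a ∈ I, a ∈ K ↔ p a ∉ K := fun K hK a ha =>
    mem_iff_notMem_of_card_support hg hS hI ha (hpI a ha) (hpg a ha) hK
  have hinj : Set.InjOn p I := by
    intro a ha b hb hab
    obtain ⟨J, hJ, hJI⟩ := exists_ne_zero_inter_eq hg hI (Finset.singleton_subset_iff.2 ha)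
    have h1 : a ∈ J ∩ I := by simp [hJI]
    have h2 : b ∈ J := by
      rw [htrans J hJ b hb, ← hab, ← htrans J hJ a ha]
      exact (Finset.mem_inter.1 h1).1
    have h3 : b ∈ J ∩ I := Finset.mem_inter.2 ⟨h2, hb⟩
    rw [hJI, Finset.mem_singleton] at h3
    exact h3.symm
  let P : CoordinatePairing n i :=
    { M := I
      M' := I.image p
      prime := p
      card_M := hIc
      card_M' := by rw [Finset.card_image_of_injOn hinj, hIc]
      disjoint := by
        rw [Finset.disjoint_right]
        intro b hb
        obtain ⟨a, ha, rfl⟩ := Finset.mem_image.1 hb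
        exact hpI a ha
      bijOn := by
        rw [Finset.coe_image]
        exact hinj.bijOn_image }
  refine ⟨P, (-1) ^ i * g I, mul_ne_zero (pow_ne_zero _ (by norm_num)) hI, fun J hJc => ?_⟩
  by_cases hJ : g J = 0
  · rw [hJ, P.altProd_of_not_isTransversal, mul_zero]
    intro hJP
    -- The set of the support with the same trace on `M` as the transversal `J` contains `J`.
    obtain ⟨K, hK, hKI⟩ := exists_ne_zero_inter_eq hg hI (Finset.inter_subset_right (s₁ := J))
    have hKP : P.IsTransversal K := htrans K hK
    have hiff : ∀ m ∈ I, m ∈ K ↔ m ∈ J := by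
      intro m hm
      have := Finset.ext_iff.1 hKI m
      simpa [hm] using this
    have hJM : J ⊆ P.M ∪ P.M' := by
      have h1 := P.card_inter_of_isTransversal hJP
      rw [← Finset.inter_eq_left]
      exact Finset.eq_of_subset_of_card_le Finset.inter_subset_left (by rw [h1, hJc])
    have hJK : J ⊆ K := by
      intro a ha
      rcases Finset.mem_union.1 (hJM ha) with h | h
      · exact (hiff a h).2 ha
      · obtain ⟨m, hm, rfl⟩ := P.exists_prime_eq h
        have h1 := hJP m hm
        have h2 := hKP m hm
        have h3 := hiff m hm
        tauto
    rw [Finset.eq_of_subset_of_card_le hJK (by rw [hg.card_of_ne_zero K hK, hJc])] at hJ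
    exact hK hJ
  · rw [P.altProd_of_isTransversal (htrans J hJ),
      eq_neg_one_pow_mul_of_card_support hg hS hI hJ]
    have h1 := Finset.card_sdiff_add_card_inter I J
    rw [hIc] at h1
    change _ = _ * (-1) ^ (I ∩ J).card
    rw [← h1, pow_add]
    rcases neg_one_pow_eq_or ℝ (I ∩ J).card with h | h <;> rw [h] <;> ring

/-! ### Comparing the supports of a null design and of its subset sums -/

section Counting

variable {α : Type*} [DecidableEq α] [Fintype α] {i : ℕ} {g : Finset α → ℝ}

/-- For every `I` in the support of `g` and every `w`-set `Y` disjoint from `I`, the function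
`subsetSum i g` is nonzero on some `w`-subset `x` of `I ∪ Y`. For each `x` there are at most
`(n - w).choose i` sets `I ∪ Y` containing `x`, and `(w + i).choose i` ways to choose `I` in it. -/
theorem card_support_mul_choose_le (hg : IsNullDesign i g) {w : ℕ} (hiw : i ≤ w) :
    (Finset.univ.filter fun J => g J ≠ 0).card * (Fintype.card α - i).choose w ≤
      ((Finset.univ.powersetCard w).filter fun x => subsetSum i g x ≠ 0).card *
        ((Fintype.card α - w).choose i * (w + i).choose i) := by
  set S := Finset.univ.filter fun J => g J ≠ 0 with hS
  set A := (Finset.univ.powersetCard w).filter fun x => subsetSum i g x ≠ 0 with hA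
  have hQ : (S.sigma fun I => Iᶜ.powersetCard w).card =
      S.card * (Fintype.card α - i).choose w := by
    rw [Finset.card_sigma, Finset.sum_const_nat]
    intro I hI
    rw [Finset.card_powersetCard, Finset.card_compl,
      hg.card_of_ne_zero I (Finset.mem_filter.1 hI).2]
  let R : Finset (Σ _ : Finset α, Finset α) := A.biUnion fun x => (xᶜ.powersetCard i).biUnion
    fun E => ((x ∪ E).powersetCard i).image fun I => ⟨I, (x ∪ E) \ I⟩
  have hR : R.card ≤ A.card * ((Fintype.card α - w).choose i * (w + i).choose i) := by
    refine Finset.card_biUnion_le_card_mul _ _ _ fun x hx => ?_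
    have hxw : x.card = w := (Finset.mem_powersetCard.1 (Finset.mem_filter.1 hx).1).2
    have h1 : (xᶜ.powersetCard i).card = (Fintype.card α - w).choose i := by
      rw [Finset.card_powersetCard, Finset.card_compl, hxw]
    rw [← h1]
    refine Finset.card_biUnion_le_card_mul _ _ _ fun E hE => ?_
    obtain ⟨hEx, hEi⟩ := Finset.mem_powersetCard.1 hE
    refine Finset.card_image_le.trans ?_
    rw [Finset.card_powersetCard, Finset.card_union_of_disjoint, hxw, hEi]
    exact (Finset.disjoint_left.2 fun a ha => Finset.mem_compl.1 (hEx ha)).symm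
  rw [← hQ]
  refine (Finset.card_le_card ?_).trans hR
  rintro ⟨I, Y⟩ hp
  obtain ⟨hI, hY⟩ := Finset.mem_sigma.1 hp
  obtain ⟨hYI, hYw⟩ := Finset.mem_powersetCard.1 hY
  have hI0 : g I ≠ 0 := (Finset.mem_filter.1 hI).2
  have hIi := hg.card_of_ne_zero I hI0
  have hdisj : Disjoint I Y :=
    (Finset.disjoint_left.2 fun a ha => Finset.mem_compl.1 (hYI ha)).symm
  have hV : (I ∪ Y).card = i + w := by rw [Finset.card_union_of_disjoint hdisj, hIi, hYw]
  obtain ⟨x, hxV, hxw, hx0⟩ : ∃ x ⊆ I ∪ Y, x.card = w ∧ subsetSum i g x ≠ 0 := by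
    by_contra! h
    exact hI0 (eq_zero_of_subsetSum_eq_zero hiw hV Finset.subset_union_left hIi h)
  simp only [R, Finset.mem_biUnion, Finset.mem_image]
  refine ⟨x, by simp [hA, hxw, hx0], (I ∪ Y) \ x, ?_, I, ?_, ?_⟩
  · rw [Finset.mem_powersetCard, Finset.card_sdiff_of_subset hxV, hV, hxw]
    exact ⟨fun a ha => Finset.mem_compl.2 (Finset.mem_sdiff.1 ha).2, by omega⟩
  · rw [Finset.union_sdiff_of_subset hxV, Finset.mem_powersetCard]
    exact ⟨Finset.subset_union_left, hIi⟩
  · rw [Finset.union_sdiff_of_subset hxV, Finset.union_sdiff_cancel_left hdisj]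

/-- A set `I ∪ Z` with `I` in the support of `g` and `Z` disjoint from all sets of the support
contains no other set of the support, so `subsetSum i g` takes the value `g I` there. -/
theorem card_support_mul_choose_le_of_card_le (hg : IsNullDesign i g) (k K : ℕ)
    (hK : (Finset.univ.filter fun J => g J ≠ 0).card ≤ K) :
    (Finset.univ.filter fun J => g J ≠ 0).card * (Fintype.card α - K * i).choose k ≤
      ((Finset.univ.powersetCard (i + k)).filter fun x => subsetSum i g x ≠ 0).card := by
  set S := Finset.univ.filter fun J => g J ≠ 0 with hS
  set U := S.biUnion id with hU
  have hSi : ∀ I ∈ S, I.card = i := fun I hI => hg.card_of_ne_zero I (Finset.mem_filter.1 hI).2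
  have hUc : U.card ≤ K * i :=
    (Finset.card_biUnion_le_card_mul _ _ i fun I hI => (hSi I hI).le).trans
      (Nat.mul_le_mul_right i hK)
  have hSU : ∀ I ∈ S, I ⊆ U := fun I hI => Finset.subset_biUnion_of_mem id hI
  have hZU : ∀ Z ∈ Uᶜ.powersetCard k, Disjoint U Z := fun Z hZ =>
    (Finset.disjoint_left.2 fun a ha =>
      Finset.mem_compl.1 ((Finset.mem_powersetCard.1 hZ).1 ha)).symm
  have hinter : ∀ I ∈ S, ∀ Z ∈ Uᶜ.powersetCard k, (I ∪ Z) ∩ U = I := by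
    intro I hI Z hZ
    rw [Finset.union_inter_distrib_right, Finset.inter_eq_left.2 (hSU I hI),
      Finset.disjoint_iff_inter_eq_empty.1 (hZU Z hZ).symm, Finset.union_empty]
  calc S.card * (Fintype.card α - K * i).choose k
      ≤ S.card * (Uᶜ.powersetCard k).card := by
        rw [Finset.card_powersetCard, Finset.card_compl]
        exact Nat.mul_le_mul_left _ (Nat.choose_le_choose k (by omega))
    _ = (S ×ˢ Uᶜ.powersetCard k).card := (Finset.card_product _ _).symm
    _ ≤ _ := by
        refine Finset.card_le_card_of_injOn (fun p => p.1 ∪ p.2) ?_ ?_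
        · rintro ⟨I, Z⟩ hp
          obtain ⟨hI, hZ⟩ := Finset.mem_product.1 (Finset.mem_coe.1 hp)
          have hIZ : Disjoint I Z := Finset.disjoint_of_subset_left (hSU I hI) (hZU Z hZ)
          simp only [Finset.mem_coe, Finset.mem_filter, Finset.mem_powersetCard,
            Finset.subset_univ, true_and]
          refine ⟨?_, ?_⟩
          · rw [Finset.card_union_of_disjoint hIZ, hSi I hI, (Finset.mem_powersetCard.1 hZ).2]
          · rw [subsetSum, Finset.sum_eq_single I]
            · exact (Finset.mem_filter.1 hI).2
            · intro J hJ hJI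
              obtain ⟨hJs, hJi⟩ := Finset.mem_powersetCard.1 hJ
              by_contra hJ0
              have hJS : J ∈ S := by simpa [hS] using hJ0
              have h1 : J ⊆ I := by
                rw [← hinter I hI Z hZ]
                exact Finset.subset_inter hJs (hSU J hJS)
              exact hJI (Finset.eq_of_subset_of_card_le h1 (by rw [hSi I hI, hJi]))
            · intro h
              exact absurd (Finset.mem_powersetCard.2 ⟨Finset.subset_union_left, hSi I hI⟩) h
        · rintro ⟨I, Z⟩ hp ⟨J, W⟩ hq h
          obtain ⟨hI, hZ⟩ := Finset.mem_product.1 (Finset.mem_coe.1 hp)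
          obtain ⟨hJ, hW⟩ := Finset.mem_product.1 (Finset.mem_coe.1 hq)
          change I ∪ Z = J ∪ W at h
          have h1 : I = J := by rw [← hinter I hI Z hZ, h, hinter J hJ W hW]
          subst h1
          have h2 : Disjoint I Z := Finset.disjoint_of_subset_left (hSU I hI) (hZU Z hZ)
          have h3 : Disjoint I W := Finset.disjoint_of_subset_left (hSU I hI) (hZU W hW)
          rw [← Finset.union_sdiff_cancel_left h2, h, Finset.union_sdiff_cancel_left h3]

/-- If `subsetSum i g` has at most `2 ^ i * (n - 2 * i).choose k` nonzero values on the
`(i + k)`-sets, then the support of `g` is bounded independently of `n`. -/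
theorem card_support_le (hg : IsNullDesign i g) (k : ℕ) (hn : 2 * i + k ≤ Fintype.card α)
    (h : ((Finset.univ.powersetCard (i + k)).filter fun x => subsetSum i g x ≠ 0).card ≤
      2 ^ i * (Fintype.card α - 2 * i).choose k) :
    (Finset.univ.filter fun J => g J ≠ 0).card ≤
      2 ^ i * (i + k).choose i * (i + k + i).choose i := by
  have h1 := card_support_mul_choose_le hg (Nat.le_add_right i k)
  have h2 : (Fintype.card α - i).choose (i + k) * (i + k).choose i =
      (Fintype.card α - i).choose i * (Fintype.card α - 2 * i).choose k := by
    rw [Nat.choose_mul (Nat.le_add_right i k), Nat.add_sub_cancel_left, Nat.sub_sub, two_mul]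
  have h3 : (Fintype.card α - (i + k)).choose i ≤ (Fintype.card α - i).choose i :=
    Nat.choose_le_choose i (by omega)
  refine Nat.le_of_mul_le_mul_right (c := (Fintype.card α - i).choose (i + k)) ?_
    (Nat.choose_pos (by omega))
  calc _ ≤ _ := h1
    _ ≤ 2 ^ i * (Fintype.card α - 2 * i).choose k *
        ((Fintype.card α - i).choose i * (i + k + i).choose i) := by gcongr
    _ = 2 ^ i * ((Fintype.card α - i).choose i * (Fintype.card α - 2 * i).choose k) *
        (i + k + i).choose i := by ring
    _ = _ := by rw [← h2]; ring

end Counting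

open Filter Asymptotics in
/-- Both binomial coefficients are asymptotic to `n ^ k / k!`, so their ratio tends to one. -/
theorem exists_forall_mul_choose_lt (c m k : ℕ) :
    ∃ N, ∀ n, N ≤ n → c * (n + m).choose k < (c + 1) * n.choose k := by
  have h1 : (fun n : ℕ => ((n + m : ℕ) : ℝ)) ~[atTop] fun n : ℕ => (n : ℝ) := by
    have h2 : (fun _ : ℕ => (m : ℝ)) =o[atTop] fun n : ℕ => (n : ℝ) :=
      isLittleO_const_left.2
        (Or.inr (tendsto_norm_atTop_atTop.comp (tendsto_natCast_atTop_atTop (R := ℝ))))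
    have h3 := (IsEquivalent.refl (u := fun n : ℕ => (n : ℝ)) (l := atTop)).add_isLittleO h2
    refine h3.congr_left (Eventually.of_forall fun n => ?_)
    simp
  have h2 : (fun n : ℕ => ((n + m).choose k : ℝ)) ~[atTop] fun n : ℕ => (n.choose k : ℝ) :=
    (((isEquivalent_choose k).comp_tendsto (tendsto_add_atTop_nat m)).trans
      ((h1.pow k).div IsEquivalent.refl)).trans (isEquivalent_choose k).symm
  obtain ⟨φ, hφ, h3⟩ := h2.exists_eq_mul
  have h4 : ∀ᶠ n in atTop, (c : ℝ) * φ n < c + 1 := by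
    have := hφ.const_mul (c : ℝ)
    exact this.eventually_lt_const (by simp)
  obtain ⟨N, hN⟩ := eventually_atTop.1 (h3.and (h4.and (eventually_ge_atTop k)))
  refine ⟨N, fun n hn => ?_⟩
  obtain ⟨h5, h6, h7⟩ := hN n hn
  have h8 : (0 : ℝ) < n.choose k := by exact_mod_cast Nat.choose_pos h7
  have h9 : (c : ℝ) * (n + m).choose k < (c + 1) * n.choose k := by
    change ((n + m).choose k : ℝ) = φ n * n.choose k at h5
    rw [h5, ← mul_assoc]
    exact mul_lt_mul_of_pos_right h6 h8
  exact_mod_cast h9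

/-! ### Eigenfunctions of the Johnson graph -/

section Johnson

variable {n w : ℕ}

theorem sum_neighborFinset_johnsonGraph (F : Finset (Fin n) → ℝ) (x : JohnsonVertex n w) :
    ∑ y ∈ (johnsonGraph n w).neighborFinset x, F y.1 = exchangeSum F x.1 := by
  obtain ⟨x, hx⟩ := x
  rw [exchangeSum, Finset.sum_sigma', eq_comm]
  have hins : ∀ a ∈ x, ∀ b ∉ x, x ∩ insert b (x.erase a) = x.erase a := by
    intro a _ b hb
    rw [Finset.inter_insert_of_notMem hb, Finset.inter_eq_right]
    exact Finset.erase_subset a x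
  have hcard : ∀ a ∈ x, (x.erase a).card + 1 = w := fun a ha => by
    rw [Finset.card_erase_add_one ha, hx]
  have hsdiff : ∀ a ∈ x, ∀ b ∉ x, insert b (x.erase a) \ x = {b} ∧
      x \ insert b (x.erase a) = {a} := by
    intro a ha b hb
    constructor
    · ext c
      simp only [Finset.mem_sdiff, Finset.mem_insert, Finset.mem_erase, Finset.mem_singleton]
      constructor
      · tauto
      · rintro rfl
        tauto
    · ext c
      simp only [Finset.mem_sdiff, Finset.mem_insert, Finset.mem_erase, Finset.mem_singleton]
      constructor
      · tauto
      · rintro rfl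
        refine ⟨ha, ?_⟩
        rintro (rfl | h)
        · exact hb ha
        · exact h.1 rfl
  refine Finset.sum_bij
    (fun p hp => ⟨insert p.2 (x.erase p.1), by
      simp only [Finset.mem_sigma, Finset.mem_compl] at hp
      rw [Finset.card_insert_of_notMem (fun h => hp.2 (Finset.mem_of_mem_erase h)),
        hcard _ hp.1]⟩) ?_ ?_ ?_ ?_
  · rintro ⟨a, b⟩ hp
    simp only [Finset.mem_sigma, Finset.mem_compl] at hp
    rw [SimpleGraph.mem_neighborFinset]
    change (x ∩ insert b (x.erase a)).card + 1 = w
    rw [hins a hp.1 b hp.2, hcard a hp.1]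
  · rintro ⟨a, b⟩ hp ⟨c, d⟩ hq h
    simp only [Finset.mem_sigma, Finset.mem_compl] at hp hq
    simp only [Subtype.mk.injEq] at h
    have h1 := (hsdiff a hp.1 b hp.2).1
    have h2 := (hsdiff a hp.1 b hp.2).2
    rw [h, (hsdiff c hq.1 d hq.2).1] at h1
    rw [h, (hsdiff c hq.1 d hq.2).2] at h2
    rw [Finset.singleton_inj.1 h1, Finset.singleton_inj.1 h2]
  · rintro ⟨y, hy⟩ hyx
    rw [SimpleGraph.mem_neighborFinset] at hyx
    change (x ∩ y).card + 1 = w at hyx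
    have h1 := Finset.card_sdiff_add_card_inter x y
    have h2 := Finset.card_sdiff_add_card_inter y x
    rw [Finset.inter_comm y x] at h2
    obtain ⟨a, ha⟩ := Finset.card_eq_one.1 (show (x \ y).card = 1 by omega)
    obtain ⟨b, hb⟩ := Finset.card_eq_one.1 (show (y \ x).card = 1 by omega)
    have ha' : a ∈ x \ y := by simp [ha]
    have hb' : b ∈ y \ x := by simp [hb]
    rw [Finset.mem_sdiff] at ha' hb'
    refine ⟨⟨a, b⟩, by simp [ha'.1, hb'.2], ?_⟩
    rw [Subtype.mk.injEq]
    have h3 : x.erase a = x ∩ y := by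
      rw [← Finset.sdiff_singleton_eq_erase, ← ha, Finset.sdiff_sdiff_self_left]
    change insert b (x.erase a) = y
    rw [h3, ← Finset.singleton_union, ← hb, Finset.inter_comm, Finset.sdiff_union_inter]
  · intro p hp
    rfl

/-- The adjacency operator of `J(n,w)` is `upSum ∘ downSum - w`, so the eigenvalue `λ_i(n,w)`
corresponds to the eigenvalue `(w - i)(n - w - i + 1)` of `upSum ∘ downSum`. -/
theorem isEigenfunction_johnsonGraph_iff (i : ℕ) (F : Finset (Fin n) → ℝ) :
    IsEigenfunction (johnsonGraph n w) (johnsonEigenvalue i n w) (fun x => F x.1) ↔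
      ∀ x : Finset (Fin n), x.card = w →
        upSum (downSum F) x = ((w : ℝ) - i) * ((n : ℝ) - w - i + 1) * F x := by
  have key : ∀ x : Finset (Fin n), x.card = w →
      (johnsonEigenvalue i n w * F x = exchangeSum F x ↔
        upSum (downSum F) x = ((w : ℝ) - i) * ((n : ℝ) - w - i + 1) * F x) := by
    intro x hx
    rw [upSum_downSum, hx, johnsonEigenvalue]
    constructor <;> intro h <;> linear_combination -h
  constructor
  · intro h x hx
    rw [← key x hx, ← sum_neighborFinset_johnsonGraph F ⟨x, hx⟩]
    exact h ⟨x, hx⟩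
  · intro h x
    rw [sum_neighborFinset_johnsonGraph F x]
    exact (key x.1 x.2).2 (h x.1 x.2)

theorem ncard_support_johnsonVertex (F : Finset (Fin n) → ℝ) :
    (Function.support fun x : JohnsonVertex n w => F x.1).ncard =
      ((Finset.univ.powersetCard w).filter fun x => F x ≠ 0).card := by
  rw [← Set.ncard_coe_finset, ← Set.ncard_image_of_injective _ Subtype.val_injective]
  congr 1
  ext x
  simp [and_comm]

theorem CoordinatePairing.isEigenfunction_toFun {i : ℕ} (P : CoordinatePairing n i) (w : ℕ) :
    IsEigenfunction (johnsonGraph n w) (johnsonEigenvalue i n w) (P.toFun w) := by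
  have h : P.toFun w = fun x => P.altProd x.1 := funext (P.toFun_eq_altProd w)
  rw [h, isEigenfunction_johnsonGraph_iff]
  intro x hx
  have h1 : upSum (downSum P.altProd) x = ((n : ℝ) - w - i + 1) * upSum P.altProd x := by
    rw [upSum, upSum, Finset.mul_sum]
    refine Finset.sum_congr rfl fun a ha => ?_
    have h2 : ((x.erase a).card : ℝ) + 1 = w := by
      rw [← hx]
      exact_mod_cast Finset.card_erase_add_one ha
    rw [P.downSum_altProd, ← h2]
    ring
  rw [h1, P.upSum_altProd, hx]
  ring

theorem CoordinatePairing.ncard_support_toFun {i : ℕ} (P : CoordinatePairing n i) (k : ℕ) :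
    (Function.support (P.toFun (i + k))).ncard = 2 ^ i * (n - 2 * i).choose k := by
  classical
  have h : P.toFun (i + k) = fun x => P.altProd x.1 := funext (P.toFun_eq_altProd (i + k))
  rw [h, ncard_support_johnsonVertex, ← P.card_isTransversal k]
  simp only [P.altProd_ne_zero_iff]

end Johnson

/-- An eigenfunction is `subsetSum i g` for a null design `g`. When its support is at most the
claimed minimum, the support of `g` is bounded independently of `n`; for large `n` the support of
the eigenfunction then consists essentially of `(n - O(1)).choose k` sets for each element of the
support of `g`, which leaves only `2 ^ i` elements for the latter. -/
theorem exists_toFun_of_ncard_support_le (i k : ℕ) : ∃ n₀ : ℕ, 2 * i ≤ n₀ ∧ ∀ n : ℕ, n₀ ≤ n →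
    ∀ f : JohnsonVertex n (i + k) → ℝ, f ≠ 0 →
      IsEigenfunction (johnsonGraph n (i + k)) (johnsonEigenvalue i n (i + k)) f →
      (Function.support f).ncard ≤ 2 ^ i * (n - 2 * i).choose k →
      ∃ (P : CoordinatePairing n i) (c : ℝ), c ≠ 0 ∧ f = c • P.toFun (i + k) := by
  set K := 2 ^ i * (i + k).choose i * (i + k + i).choose i with hK
  obtain ⟨N, hN⟩ := exists_forall_mul_choose_lt (2 ^ i) (K * i) k
  refine ⟨N + K * i + (2 * i + k), by omega, fun n hn f hf0 hf hsupp => ?_⟩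
  let F : Finset (Fin n) → ℝ := fun x => if h : x.card = i + k then f ⟨x, h⟩ else 0
  have hF : f = fun x => F x.1 := by
    funext x
    simp [F, x.2]
  have hcard : 2 * i + k ≤ Fintype.card (Fin n) := by
    rw [Fintype.card_fin]
    omega
  rw [hF, isEigenfunction_johnsonGraph_iff] at hf
  obtain ⟨g, hg, hFg⟩ := exists_isNullDesign_subsetSum i k hcard F (fun x hx => by
    rw [hf x hx, Fintype.card_fin]
    push_cast
    ring)
  have hfg : f = fun x => subsetSum i g x.1 := by
    rw [hF]
    exact funext fun x => hFg x.1 x.2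
  rw [hfg, ncard_support_johnsonVertex] at hsupp
  obtain ⟨I, hI⟩ : ∃ I, g I ≠ 0 := by
    by_contra! h
    refine hf0 (hfg.trans (funext fun x => ?_))
    simp [subsetSum, h]
  have hSK := card_support_le hg k hcard (by rwa [Fintype.card_fin])
  have hlow := card_support_mul_choose_le_of_card_le hg k K hSK
  rw [Fintype.card_fin] at hlow
  have hS : (Finset.univ.filter fun J => g J ≠ 0).card ≤ 2 ^ i := by
    by_contra! hlt
    have h1 := hN (n - K * i) (by omega)
    rw [Nat.sub_add_cancel (by omega)] at h1
    have h2 : 2 ^ i * (n - 2 * i).choose k ≤ 2 ^ i * n.choose k :=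
      Nat.mul_le_mul_left _ (Nat.choose_le_choose k (Nat.sub_le _ _))
    have h3 := Nat.mul_le_mul_right ((n - K * i).choose k) (Nat.succ_le_of_lt hlt)
    exact absurd (h3.trans (hlow.trans (hsupp.trans h2))) (not_le.2 h1)
  obtain ⟨P, c, hc, hgP⟩ := exists_eq_altProd_of_card_support hg hS hI
  refine ⟨P, c, hc, hfg.trans (funext fun x => ?_)⟩
  rw [Pi.smul_apply, P.toFun_eq_altProd, ← P.subsetSum_altProd k x.1 x.2, smul_eq_mul,
    subsetSum, subsetSum, Finset.mul_sum]
  exact Finset.sum_congr rfl fun J hJ => hgP J (Finset.mem_powersetCard.1 hJ).2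

theorem mainTheorem1 (i w : ℕ) (hi : 0 < i) (hiw : i ≤ w) :
    ∃ n₀ : ℕ, 2 * i ≤ n₀ ∧ ∀ n : ℕ, n₀ ≤ n →
      (∀ f : JohnsonVertex n w → ℝ, f ≠ 0 →
        IsEigenfunction (johnsonGraph n w) (johnsonEigenvalue i n w) f →
          2 ^ i * (n - 2 * i).choose (w - i) ≤ (Function.support f).ncard ∧
          ((Function.support f).ncard = 2 ^ i * (n - 2 * i).choose (w - i) →
            ∃ (P : CoordinatePairing n i) (c : ℝ), c ≠ 0 ∧ f = c • P.toFun w)) ∧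
      (∀ P : CoordinatePairing n i,
        IsEigenfunction (johnsonGraph n w) (johnsonEigenvalue i n w) (P.toFun w) ∧
        (Function.support (P.toFun w)).ncard = 2 ^ i * (n - 2 * i).choose (w - i)) := by
  obtain ⟨k, rfl⟩ := Nat.exists_eq_add_of_le hiw
  rw [Nat.add_sub_cancel_left]
  obtain ⟨n₀, h2i, h⟩ := exists_toFun_of_ncard_support_le i k
  refine ⟨n₀, h2i, fun n hn => ⟨fun f hf0 hf => ⟨?_, fun heq => h n hn f hf0 hf heq.le⟩,
    fun P => ⟨P.isEigenfunction_toFun (i + k), P.ncard_support_toFun k⟩⟩⟩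
  by_contra! hlt
  obtain ⟨P, c, hc, rfl⟩ := h n hn f hf0 hf hlt.le
  rw [Function.support_const_smul_of_ne_zero _ _ hc, P.ncard_support_toFun k] at hlt
  exact lt_irrefl _ hlt
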